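/- For every error bound $\varepsilon>0$ there is a constant $C$, depending only on $\varepsilon$, such that the following holds for every integer $n\ge 2$ and every finite Abelian group $G$ with $|G|\le 2^n$. There is a quantum simultaneous-message-passing protocol for $\mathrm{Lin}_4$ over $G$ in which the total number of qubits sent is at most $C\sqrt n\,\log n$. That is: each of four players holds one element $x_i\in G$ and, without shared randomness or entanglement, sends to a referee a single message, a pure state of some fixed number of qubits that depends only on $x_i$. The referee, who receives the tensor product of the four messages and sees no input, performs a two-outcome quantum measurement on it. For all $x_1,x_2,x_3,x_4\in G$, the referee accepts with probability at least $1-\varepsilon$ if $x_1+x_2+x_3+x_4=0$ in $G$, and with probability at most $\varepsilon$ otherwise. -/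

import Mathlib

open scoped Matrix ComplexOrder

noncomputable section

/-- A quantum protocol in the simultaneous message passing model, with `k` players whose inputs
lie in `X`, and without shared randomness or shared entanglement. On input `x`, player `i` prepares
a unit vector of the state space of `qubits i` qubits, with computational basis
`Fin (qubits i) → Fin 2`, which depends only on `i` and `x`. The referee applies to all the
messages together an arbitrary two-outcome quantum measurement (POVM) `{accept, 1 - accept}`. -/
structure QuantumSMPProtocol (k : ℕ) (X : Type*) where
  /-- the number of qubits sent by each player -/
  qubits : Fin k → ℕ
  /-- the message of each player, as a function of the input of that player -/
  message : (i : Fin k) → X → EuclideanSpace ℂ (Fin (qubits i) → Fin 2)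
  norm_message : ∀ i x, ‖message i x‖ = 1
  /-- the measurement operator of the referee for the outcome "accept" -/
  accept : Matrix ((i : Fin k) → Fin (qubits i) → Fin 2) ((i : Fin k) → Fin (qubits i) → Fin 2) ℂ
  accept_posSemidef : accept.PosSemidef
  one_sub_accept_posSemidef : (1 - accept).PosSemidef

namespace QuantumSMPProtocol

/-- The communication cost: the total number of qubits sent to the referee. -/
def cost {k : ℕ} {X : Type*} (P : QuantumSMPProtocol k X) : ℕ :=
  ∑ i, P.qubits i

/-- The state received by the referee: the tensor product of the messages of the players,
in the product basis. -/
def jointState {k : ℕ} {X : Type*} (P : QuantumSMPProtocol k X) (x : Fin k → X) :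
    ((i : Fin k) → Fin (P.qubits i) → Fin 2) → ℂ :=
  fun b => ∏ i, P.message i (x i) (b i)

/-- The probability `⟨Ψ, accept Ψ⟩` that the referee accepts, where `Ψ` is the joint state. -/
def acceptProb {k : ℕ} {X : Type*} (P : QuantumSMPProtocol k X) (x : Fin k → X) : ℝ :=
  (star (P.jointState x) ⬝ᵥ (P.accept *ᵥ P.jointState x)).re

/-- The protocol decides the predicate `R` of the inputs with error probability at most `ε`
on every input. -/
def Decides {k : ℕ} {X : Type*} (P : QuantumSMPProtocol k X) (R : (Fin k → X) → Prop)
    (ε : ℝ) : Prop :=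
  ∀ x : Fin k → X, (R x → 1 - ε ≤ P.acceptProb x) ∧ (¬ R x → P.acceptProb x ≤ ε)

end QuantumSMPProtocol

/-- The co-linearity predicate with `k` players and addition in `G`. -/
def Lin (k : ℕ) (G : Type*) [AddCommGroup G] (x : Fin k → G) : Prop :=
  ∑ i, x i = 0

end

/-! ### Characters with small sums -/

noncomputable section

/-! Let `m = |R|` be of order `n`. Player `i` sends copies of the fingerprint `m^(-1/2) ∑ r, χ r (y
i) |r⟩`, where `y` is the input, negated for players `2` and `3`. Co-linearity then reads `y 0 + y 1
= y 2 + y 3`. With `t` of order `√m` copies each, the birthday paradox gives, with constant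
probability, exactly one collision between players `0` and `1`, at a value `v`, exactly one between
players `2` and `3`, at a value `w`, and no other coincidence. Exchanging `v` and `w` multiplies the
amplitude by `conj (χ v s) * χ w s`, where `s = y 0 + y 1 - y 2 - y 3`.

This exchange, extended by the identity, is an involution of the basis, and the referee projects
onto its invariant vectors. If `s = 0`, the state is invariant and accepted with certainty. If `s ≠
0`, the average of the factor over `v, w` is `‖∑ r, χ r s‖² / m²`, at most `1/2` for a suitable
random family of characters (`exists_addChar_family`). Since good collisions have constant weight
(`le_sum_collides`), the overlap drops by a constant (`sum_re_star_phase_mul_phase_le`). A constant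
number `l` of independent blocks reduces the error to `ε`. Each copy costs `log m` qubits, whence
the total of order `√n log n`. -/

/-- Exponential moment bound for a finite family of reals in `[-1, 1]` with mean zero. -/
theorem sum_exp_half_le {ι : Type*} [Fintype ι] (f : ι → ℝ) (hf : ∀ i, |f i| ≤ 1)
    (h0 : ∑ i, f i = 0) :
    ∑ i, Real.exp (f i * (1 / 2)) ≤ Fintype.card ι * Real.exp (1 / 8) := by
  calc ∑ i, Real.exp (f i * (1 / 2))
      ≤ ∑ i, (Real.cosh (1 / 2) + f i * Real.sinh (1 / 2)) :=
        Finset.sum_le_sum fun i _ => Real.exp_mul_le_cosh_add_mul_sinh (hf i) _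
    _ = Fintype.card ι * Real.cosh (1 / 2) := by
        rw [Finset.sum_add_distrib, ← Finset.sum_mul, h0]; simp
    _ ≤ _ := by
        have := Real.cosh_le_exp_half_sq (1 / 2)
        norm_num at this ⊢
        gcongr

/-- A family of characters, of size linear in `log |G|`, for which the sums
`∑ r, χ r s` are bounded away from the trivial bound for all `s ≠ 0`. -/
theorem exists_addChar_family (n : ℕ) (G R : Type*) [AddCommGroup G] [Finite G] [Fintype R]
    (hG : Nat.card G ≤ 2 ^ n) (hR : 8 * (n + 2) ≤ Fintype.card R) :
    ∃ χ : R → AddChar G ℂ, ∀ s, s ≠ 0 →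
      ‖∑ r, χ r s‖ ^ 2 ≤ (Fintype.card R : ℝ) ^ 2 / 2 := by
  classical
  have := Fintype.ofFinite G
  -- Bounding the sum in these four directions controls its real and imaginary parts, each by `m /
  -- 2`. The union bound runs over at most `2 ^ (n + 2)` pairs.
  set W : Finset ℂ := {1, -1, Complex.I, -Complex.I} with hW
  have hW4 : W.card ≤ 4 := Finset.card_le_four
  have hWn : ∀ w ∈ W, ‖w‖ = 1 := by
    intro w hw
    simp only [hW, Finset.mem_insert, Finset.mem_singleton] at hw
    rcases hw with rfl | rfl | rfl | rfl <;> simp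
  set S : Finset (G × ℂ) := (Finset.univ.erase 0) ×ˢ W with hS
  set m := Fintype.card R
  have hGc : (Fintype.card G : ℝ) ≤ 2 ^ n := by
    rw [Nat.card_eq_fintype_card] at hG; exact_mod_cast hG
  let F : (R → AddChar G ℂ) → ℝ := fun χ => ∑ z ∈ S, ∏ r, Real.exp ((z.2 * χ r z.1).re * (1 / 2))
  have hsum : ∑ χ, F χ ≤ ∑ _χ : R → AddChar G ℂ, (2 : ℝ) ^ (n + 2) * Real.exp (m / 8) := by
    rw [Finset.sum_comm]
    have hz : ∀ z ∈ S, ∑ χ : R → AddChar G ℂ, ∏ r, Real.exp ((z.2 * χ r z.1).re * (1 / 2))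
        ≤ (Fintype.card (AddChar G ℂ) : ℝ) ^ m * Real.exp (m / 8) := by
      rintro ⟨s, w⟩ hz
      simp only [hS, Finset.mem_product, Finset.mem_erase, Finset.mem_univ, and_true] at hz
      rw [← Fintype.prod_sum (fun (_ : R) (ψ : AddChar G ℂ) => Real.exp ((w * ψ s).re * (1 / 2)))]
      rw [Finset.prod_const, Finset.card_univ]
      have e : Real.exp ((m : ℝ) / 8) = Real.exp (1 / 8) ^ m := by
        rw [← Real.exp_nat_mul]; congr 1; ring
      rw [e, ← mul_pow]
      refine pow_le_pow_left₀ (Finset.sum_nonneg fun _ _ => (Real.exp_pos _).le) ?_ _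
      refine sum_exp_half_le _ (fun ψ => ?_) ?_
      · refine (Complex.abs_re_le_norm _).trans ?_
        rw [norm_mul, hWn w hz.2, AddChar.norm_apply, mul_one]
      · rw [← Complex.re_sum, ← Finset.mul_sum, AddChar.sum_apply_eq_zero_iff_ne_zero.2 hz.1]
        simp
    refine (Finset.sum_le_sum hz).trans ?_
    rw [Finset.sum_const, Finset.sum_const, nsmul_eq_mul, nsmul_eq_mul, Finset.card_univ,
      Fintype.card_fun, Nat.cast_pow]
    have hSc : (S.card : ℝ) ≤ 2 ^ (n + 2) := by
      have h1 : S.card ≤ Fintype.card G * 4 := by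
        rw [hS, Finset.card_product]
        exact Nat.mul_le_mul (Finset.card_le_univ _) hW4
      calc (S.card : ℝ) ≤ Fintype.card G * 4 := by exact_mod_cast h1
        _ ≤ 2 ^ n * 4 := by gcongr
        _ = _ := by ring
    calc (S.card : ℝ) * ((Fintype.card (AddChar G ℂ) : ℝ) ^ m * Real.exp (m / 8))
        ≤ 2 ^ (n + 2) * ((Fintype.card (AddChar G ℂ) : ℝ) ^ m * Real.exp (m / 8)) := by gcongr
      _ = _ := by ring
  obtain ⟨χ, -, hχ⟩ := Finset.exists_le_of_sum_le Finset.univ_nonempty hsum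
  refine ⟨χ, fun s hs => ?_⟩
  have key : ∀ w ∈ W, (w * ∑ r, χ r s).re ≤ m / 2 := by
    intro w hw
    have h1 : Real.exp ((w * ∑ r, χ r s).re * (1 / 2)) ≤ 2 ^ (n + 2) * Real.exp (m / 8) := by
      refine le_trans ?_ hχ
      have : Real.exp ((w * ∑ r, χ r s).re * (1 / 2))
          = ∏ r, Real.exp ((w * χ r s).re * (1 / 2)) := by
        rw [← Real.exp_sum, ← Finset.sum_mul, ← Complex.re_sum, ← Finset.mul_sum]
      rw [this]
      exact Finset.single_le_sum
        (f := fun z : G × ℂ => ∏ r, Real.exp ((z.2 * χ r z.1).re * (1 / 2)))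
        (fun _ _ => Finset.prod_nonneg fun _ _ => (Real.exp_pos _).le)
        (by simp [hS, hs, hw] : (s, w) ∈ S)
    have h2 : (2 : ℝ) ^ (n + 2) ≤ Real.exp ((n : ℝ) + 2) := by
      have : (2 : ℝ) ≤ Real.exp 1 := by linarith [Real.add_one_le_exp 1]
      calc (2 : ℝ) ^ (n + 2) ≤ Real.exp 1 ^ (n + 2) := by gcongr
        _ = _ := by rw [← Real.exp_nat_mul]; push_cast; ring_nf
    have h3 := h1.trans (mul_le_mul_of_nonneg_right h2 (Real.exp_pos _).le)
    rw [← Real.exp_add, Real.exp_le_exp] at h3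
    have h4 : (8 : ℝ) * (n + 2) ≤ m := by exact_mod_cast hR
    linarith
  have k1 := key 1 (by simp [hW])
  have k2 := key (-1) (by simp [hW])
  have k3 := key Complex.I (by simp [hW])
  have k4 := key (-Complex.I) (by simp [hW])
  simp only [one_mul, neg_mul, Complex.neg_re, Complex.I_mul_re, neg_neg] at k1 k2 k3 k4
  rw [← Complex.normSq_eq_norm_sq, Complex.normSq_apply]
  generalize (∑ r, χ r s).re = a at *
  generalize (∑ r, χ r s).im = b at *
  nlinarith

/-! ### Averaging over a free coordinate -/

section FreeCoordinate

variable {P R : Type*} [Fintype P] [DecidableEq P] [Fintype R]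

theorem sum_sum_update (p : P) (F : (P → R) → ℝ) :
    ∑ b : P → R, ∑ v, F (Function.update b p v) = Fintype.card R * ∑ b, F b := by
  -- Exchanging the entry at `p` with the spare value is a bijection.
  let e : (P → R) × R → (P → R) × R := fun z => (Function.update z.1 p z.2, z.1 p)
  have he : Function.Involutive e := by
    rintro ⟨b, v⟩
    simp [e]
  have h := Equiv.sum_comp he.toPerm (fun z : (P → R) × R => F z.1)
  rw [Fintype.sum_prod_type, Fintype.sum_prod_type] at h
  simpa [e, ← Finset.mul_sum] using h

/-- A coincidence involving a coordinate on which the summand does not depend has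
probability `1 / |R|`. -/
theorem card_mul_sum_ite_eq [DecidableEq R] {p q : P} (hpq : p ≠ q) (F : (P → R) → ℝ)
    (hF : ∀ b v, F (Function.update b p v) = F b) :
    Fintype.card R * ∑ b : P → R, (if b p = b q then F b else 0) = ∑ b, F b := by
  rw [← sum_sum_update p]
  refine Finset.sum_congr rfl fun b _ => ?_
  simp [hF, Function.update_of_ne hpq.symm]

theorem card_sq_mul_sum_eval_eval {p q : P} (hpq : p ≠ q) (h : R → R → ℝ) :
    (Fintype.card R : ℝ) ^ 2 * ∑ b : P → R, h (b p) (b q)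
      = (Fintype.card R : ℝ) ^ Fintype.card P * ∑ v, ∑ w, h v w := by
  have h1 := sum_sum_update p (fun b : P → R => ∑ w, h (b p) w)
  have h2 := sum_sum_update q (fun b : P → R => h (b p) (b q))
  simp only [Function.update_self, Function.update_of_ne hpq] at h1 h2
  rw [pow_two, mul_assoc, ← h2, ← h1]
  simp

end FreeCoordinate

/-! ### The involution exchanging two collisions -/

section Collisions

variable {t : ℕ} {R : Type*}

/-- The exchange of the selected position of each of the four players with the one of the
player two places further. -/
def swapPos (τ : Fin 4 → Fin t) (p : Fin 4 × Fin t) : Fin 4 × Fin t :=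
  if p.2 = τ p.1 then (p.1 + 2, τ (p.1 + 2)) else p

theorem swapPos_of_eq {τ : Fin 4 → Fin t} {p : Fin 4 × Fin t} (h : p.2 = τ p.1) :
    swapPos τ p = (p.1 + 2, τ (p.1 + 2)) := if_pos h

theorem swapPos_of_ne {τ : Fin 4 → Fin t} {p : Fin 4 × Fin t} (h : p.2 ≠ τ p.1) :
    swapPos τ p = p := if_neg h

theorem swapPos_mem_iff {τ : Fin 4 → Fin t} {p : Fin 4 × Fin t} :
    (swapPos τ p).2 = τ (swapPos τ p).1 ↔ p.2 = τ p.1 := by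
  by_cases h : p.2 = τ p.1
  · simp [swapPos_of_eq h, h]
  · rw [swapPos_of_ne h]

theorem swapPos_involutive (τ : Fin 4 → Fin t) : Function.Involutive (swapPos τ) := by
  rintro p
  by_cases h : p.2 = τ p.1
  · have h4 : p.1 + 2 + 2 = p.1 := by generalize p.1 = i; revert i; decide
    rw [swapPos_of_eq (swapPos_mem_iff.2 h), swapPos_of_eq h]
    dsimp only
    rw [h4, ← h]
  · rw [swapPos_of_ne (p := swapPos τ p) (by rwa [ne_eq, swapPos_mem_iff]), swapPos_of_ne h]

/-- At the positions selected by `τ`, players `0` and `1` have the same value, players `2` and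
`3` have the same value, and there are no coincidences of values involving other positions. -/
def Collides (τ : Fin 4 → Fin t) (b : Fin 4 × Fin t → R) : Prop :=
  b (0, τ 0) = b (1, τ 1) ∧ b (2, τ 2) = b (3, τ 3) ∧
    ∀ p q, p ≠ q → b p = b q → p.2 = τ p.1 ∧ q.2 = τ q.1

/-- Any coincidence is confined to selected positions, so the two required ones determine all four.
Hence the choice of `τ` in `swapCollisions` is immaterial. -/
theorem Collides.unique {τ τ' : Fin 4 → Fin t} {b : Fin 4 × Fin t → R}
    (h : Collides τ b) (h' : Collides τ' b) : τ = τ' := by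
  have h1 := h'.2.2 (0, τ 0) (1, τ 1) (by simp) h.1
  have h2 := h'.2.2 (2, τ 2) (3, τ 3) (by simp) h.2.1
  funext i
  fin_cases i
  exacts [h1.1, h1.2, h2.1, h2.2]

theorem Collides.comp_swapPos {τ : Fin 4 → Fin t} {b : Fin 4 × Fin t → R}
    (h : Collides τ b) : Collides τ (b ∘ swapPos τ) := by
  refine ⟨?_, ?_, fun p q hpq hb => ?_⟩
  · simpa [swapPos] using h.2.1
  · simpa [swapPos] using h.1
  · have := h.2.2 _ _ ((swapPos_involutive τ).injective.ne hpq) hb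
    rwa [swapPos_mem_iff, swapPos_mem_iff] at this

open Classical in
/-- Exchange the two collisions if there is exactly one of them on each side and no other
coincidence, and do nothing otherwise. -/
def swapCollisions (b : Fin 4 × Fin t → R) : Fin 4 × Fin t → R :=
  if h : ∃ τ, Collides τ b then b ∘ swapPos h.choose else b

theorem Collides.swapCollisions_eq {τ : Fin 4 → Fin t} {b : Fin 4 × Fin t → R}
    (h : Collides τ b) : swapCollisions b = b ∘ swapPos τ := by
  have hex : ∃ τ, Collides τ b := ⟨τ, h⟩
  rw [swapCollisions, dif_pos hex, hex.choose_spec.unique h]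

theorem swapCollisions_of_not {b : Fin 4 × Fin t → R} (h : ¬ ∃ τ, Collides τ b) :
    swapCollisions b = b := dif_neg h

theorem swapCollisions_involutive :
    Function.Involutive (swapCollisions : (Fin 4 × Fin t → R) → _) := by
  intro b
  by_cases h : ∃ τ, Collides τ b
  · obtain ⟨τ, h⟩ := h
    rw [h.swapCollisions_eq, h.comp_swapPos.swapCollisions_eq, Function.comp_assoc,
      (swapPos_involutive τ).comp_self, Function.comp_id]
  · rw [swapCollisions_of_not h, swapCollisions_of_not h]

end Collisions

/-! ### Effect of the exchange on phases -/

section Phase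

variable {t : ℕ} {R G : Type*} [AddCommGroup G] [Finite G]

/-- The phase of the basis vector `b` in the joint state of the players. -/
def phase (χ : R → AddChar G ℂ) (y : Fin 4 → G) (b : Fin 4 × Fin t → R) : ℂ :=
  ∏ p, χ (b p) (y p.1)

theorem star_phase_mul_self (χ : R → AddChar G ℂ) (y : Fin 4 → G) (b : Fin 4 × Fin t → R) :
    star (phase χ y b) * phase χ y b = 1 := by
  have : ‖phase χ y b‖ = 1 := by simp [phase, norm_prod, AddChar.norm_apply]
  rw [Complex.star_def, Complex.conj_mul', this]; simp

theorem Collides.star_phase_mul_phase {τ : Fin 4 → Fin t} {b : Fin 4 × Fin t → R}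
    (h : Collides τ b) (χ : R → AddChar G ℂ) (y : Fin 4 → G) :
    star (phase χ y b) * phase χ y (swapCollisions b) =
      star (χ (b (0, τ 0)) (y 0 + y 1 - y 2 - y 3)) *
        χ (b (2, τ 2)) (y 0 + y 1 - y 2 - y 3) := by
  classical
  -- The unselected positions contribute a common unimodular factor, which cancels.
  set Q : ℂ := ∏ i, ∏ a ∈ Finset.univ.erase (τ i), χ (b (i, a)) (y i) with hQ
  have hQ1 : star Q * Q = 1 := by
    have : ‖Q‖ = 1 := by simp [hQ, norm_prod, AddChar.norm_apply]
    rw [Complex.star_def, Complex.conj_mul', this]; simp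
  have e1 : phase χ y b = (∏ i, χ (b (i, τ i)) (y i)) * Q := by
    rw [phase, Fintype.prod_prod_type, hQ, ← Finset.prod_mul_distrib]
    exact Finset.prod_congr rfl fun i _ =>
      (Finset.mul_prod_erase _ (fun a => χ (b (i, a)) (y i)) (Finset.mem_univ _)).symm
  have e2 : phase χ y (swapCollisions b) = (∏ i, χ (b (i + 2, τ (i + 2))) (y i)) * Q := by
    rw [phase, Fintype.prod_prod_type, hQ, ← Finset.prod_mul_distrib, h.swapCollisions_eq]
    refine Finset.prod_congr rfl fun i _ => ?_
    rw [← Finset.mul_prod_erase _ _ (Finset.mem_univ (τ i))]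
    congr 1
    · simp [swapPos]
    · refine Finset.prod_congr rfl fun a ha => ?_
      rw [Function.comp_apply, swapPos_of_ne (by simpa using ha)]
  rw [e1, e2, Fin.prod_univ_four, Fin.prod_univ_four]
  have f0 : (0 : Fin 4) + 2 = 2 := rfl
  have f1 : (1 : Fin 4) + 2 = 3 := rfl
  have f2 : (2 : Fin 4) + 2 = 0 := rfl
  have f3 : (3 : Fin 4) + 2 = 1 := rfl
  rw [f0, f1, f2, f3, ← h.1, ← h.2.1]
  simp only [sub_eq_add_neg, AddChar.map_add_eq_mul, AddChar.map_neg_eq_conj, Complex.star_def,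
    map_mul, Complex.conj_conj] at hQ1 ⊢
  linear_combination
    (starRingEnd ℂ (χ (b (0, τ 0)) (y 0)) * starRingEnd ℂ (χ (b (0, τ 0)) (y 1)) *
      starRingEnd ℂ (χ (b (2, τ 2)) (y 2)) * starRingEnd ℂ (χ (b (2, τ 2)) (y 3)) *
      (χ (b (2, τ 2)) (y 0) * χ (b (2, τ 2)) (y 1) * χ (b (0, τ 0)) (y 2) *
        χ (b (0, τ 0)) (y 3))) * hQ1

theorem star_phase_mul_phase_of_eq (χ : R → AddChar G ℂ) {y : Fin 4 → G}
    (hy : y 0 + y 1 - y 2 - y 3 = 0) (b : Fin 4 × Fin t → R) :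
    star (phase χ y b) * phase χ y (swapCollisions b) = 1 := by
  by_cases h : ∃ τ, Collides τ b
  · obtain ⟨τ, h⟩ := h
    rw [h.star_phase_mul_phase, hy]; simp
  · rw [swapCollisions_of_not h, star_phase_mul_self]

end Phase

/-! ### Counting good collisions -/

section Count

variable {t : ℕ} {R : Type*} [Fintype R] [DecidableEq R]

/-- The total weight of the configurations with exactly one collision on each side, at given
positions. -/
theorem le_sum_collides (τ : Fin 4 → Fin t) (h : R → R → ℝ) (h0 : ∀ v w, 0 ≤ h v w)
    (h2 : ∀ v w, h v w ≤ 2) [DecidablePred (Collides (R := R) τ)] (hm : 0 < Fintype.card R) :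
    (Fintype.card R : ℝ) ^ (4 * t) / (Fintype.card R : ℝ) ^ 4 *
        ((∑ v, ∑ w, h v w) - 32 * t ^ 2 * Fintype.card R)
      ≤ ∑ b : Fin 4 × Fin t → R, if Collides τ b then h (b (0, τ 0)) (b (2, τ 2)) else 0 := by
  set m : ℝ := (Fintype.card R : ℝ) with hmdef
  have hm' : 0 < m := Nat.cast_pos.2 hm
  have n10 : ((1 : Fin 4), τ 1) ≠ (0, τ 0) := by simp
  have n32 : ((3 : Fin 4), τ 3) ≠ (2, τ 2) := by simp
  have n02 : ((0 : Fin 4), τ 0) ≠ (2, τ 2) := by simp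
  have main : ∀ F : (Fin 4 × Fin t → R) → ℝ,
      (∀ b v, F (Function.update b (1, τ 1) v) = F b) →
      (∀ b v, F (Function.update b (3, τ 3) v) = F b) →
      m ^ 2 * ∑ b : Fin 4 × Fin t → R, (if b (1, τ 1) = b (0, τ 0) then
        (if b (3, τ 3) = b (2, τ 2) then F b else 0) else 0) = ∑ b, F b := by
    intro F hF1 hF3
    rw [pow_two, mul_assoc, card_mul_sum_ite_eq n10, card_mul_sum_ite_eq n32 _ hF3]
    intro b v
    rw [hF1]
    simp [Function.update_of_ne]
  have hE := main (fun b => h (b (0, τ 0)) (b (2, τ 2)))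
    (by intro b v; simp [Function.update_of_ne]) (by intro b v; simp [Function.update_of_ne])
  have hE' := card_sq_mul_sum_eval_eval n02 h
  have hone := main (fun _ => 1) (fun _ _ => rfl) (fun _ _ => rfl)
  have hcard : Fintype.card (Fin 4 × Fin t) = 4 * t := by simp
  simp only [Finset.sum_const, Finset.card_univ, nsmul_eq_mul, mul_one, Fintype.card_fun, hcard,
    Nat.cast_pow, ← hmdef] at hone hE'
  -- An unselected position is independent of the two prescribed collisions, so a further
  -- coincidence there costs another factor `1 / m`.
  have hfree : ∀ p q : Fin 4 × Fin t, p ≠ q → p.2 ≠ τ p.1 →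
      m ^ 3 * ∑ b : Fin 4 × Fin t → R, (if b p = b q then (if b (1, τ 1) = b (0, τ 0) then
        (if b (3, τ 3) = b (2, τ 2) then (1 : ℝ) else 0) else 0) else 0) = m ^ (4 * t) := by
    intro p q hpq hp
    rw [pow_succ, mul_assoc, card_mul_sum_ite_eq hpq, hone]
    intro b v
    have hne : ∀ i, (i, τ i) ≠ p := by rintro i rfl; exact hp rfl
    simp only [Function.update_of_ne (hne _)]
  have hbad : ∀ p q : Fin 4 × Fin t, p ≠ q → ¬ (p.2 = τ p.1 ∧ q.2 = τ q.1) →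
      ∑ b : Fin 4 × Fin t → R, (if b p = b q then (if b (1, τ 1) = b (0, τ 0) then
        (if b (3, τ 3) = b (2, τ 2) then (1 : ℝ) else 0) else 0) else 0) = m ^ (4 * t) / m ^ 3 := by
    intro p q hpq h
    rw [eq_div_iff (by positivity), mul_comm]
    by_cases hp : p.2 = τ p.1
    · rw [← hfree q p hpq.symm fun hq => h ⟨hp, hq⟩]
      congr 1
      exact Finset.sum_congr rfl fun b _ => by simp only [eq_comm (a := b p)]
    · exact hfree p q hpq hp
  let B : Finset ((Fin 4 × Fin t) × (Fin 4 × Fin t)) :=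
    Finset.univ.filter fun z => z.1 ≠ z.2 ∧ ¬ (z.1.2 = τ z.1.1 ∧ z.2.2 = τ z.2.1)
  have hB : (B.card : ℝ) ≤ 16 * t ^ 2 := by
    have : B.card ≤ (4 * t) * (4 * t) := by
      refine (Finset.card_le_univ _).trans_eq ?_
      simp
    calc (B.card : ℝ) ≤ ((4 * t) * (4 * t) : ℕ) := by exact_mod_cast this
      _ = _ := by push_cast; ring
  -- Union bound: two collisions failing `Collides` have an extra coincidence in `B`, whose penalty
  -- `2` covers `h ≤ 2`.
  have hpt : ∀ b : Fin 4 × Fin t → R,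
      (if b (1, τ 1) = b (0, τ 0) then
        (if b (3, τ 3) = b (2, τ 2) then h (b (0, τ 0)) (b (2, τ 2)) else 0) else 0)
      - 2 * ∑ z ∈ B, (if b z.1 = b z.2 then (if b (1, τ 1) = b (0, τ 0) then
        (if b (3, τ 3) = b (2, τ 2) then (1 : ℝ) else 0) else 0) else 0)
      ≤ if Collides τ b then h (b (0, τ 0)) (b (2, τ 2)) else 0 := by
    intro b
    have hnn : ∀ z ∈ B, (0 : ℝ) ≤ if b z.1 = b z.2 then (if b (1, τ 1) = b (0, τ 0) then
        (if b (3, τ 3) = b (2, τ 2) then (1 : ℝ) else 0) else 0) else 0 := by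
      intro z _; split_ifs <;> simp
    have hs := Finset.sum_nonneg hnn
    by_cases h1 : b (1, τ 1) = b (0, τ 0)
    swap
    · simp only [h1, if_false] at hs ⊢
      split_ifs <;> simp [h0]
    by_cases h3 : b (3, τ 3) = b (2, τ 2)
    swap
    · simp only [h3, if_false] at hs ⊢
      split_ifs <;> simp [h0]
    by_cases hc : Collides τ b
    · rw [if_pos hc, if_pos h1, if_pos h3]; linarith
    · rw [if_neg hc, if_pos h1, if_pos h3]
      have : ∃ z ∈ B, b z.1 = b z.2 := by
        by_contra! hno
        refine hc ⟨h1.symm, h3.symm, fun p q hpq hb => ?_⟩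
        by_contra hn
        exact hno (p, q) (Finset.mem_filter.2 ⟨Finset.mem_univ _, hpq, hn⟩) hb
      obtain ⟨z, hz, hbz⟩ := this
      have := Finset.single_le_sum hnn hz
      simp only [if_pos hbz, if_pos h1, if_pos h3] at this ⊢
      linarith [h2 (b (0, τ 0)) (b (2, τ 2))]
  refine le_trans ?_ (Finset.sum_le_sum fun b _ => hpt b)
  have hBsum := Finset.sum_congr rfl fun z (hz : z ∈ B) =>
    hbad z.1 z.2 (Finset.mem_filter.1 hz).2.1 (Finset.mem_filter.1 hz).2.2
  rw [Finset.sum_comm] at hBsum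
  rw [Finset.sum_sub_distrib, ← Finset.mul_sum, hBsum, Finset.sum_const, nsmul_eq_mul]
  rw [← hE, ← mul_assoc, ← pow_add] at hE'
  have e : ∀ x y : ℝ, m ^ (2 + 2) * x = m ^ (4 * t) * y → x = m ^ (4 * t) / m ^ 4 * y := by
    intro x y hxy
    rw [div_mul_eq_mul_div, eq_div_iff (by positivity), ← hxy]
    ring
  rw [e _ _ hE']
  have : (B.card : ℝ) * (m ^ (4 * t) / m ^ 3) ≤ 16 * t ^ 2 * (m ^ (4 * t) / m ^ 3) := by gcongr
  have e2 : m ^ (4 * t) / m ^ 4 * (32 * t ^ 2 * m) = 2 * (16 * t ^ 2 * (m ^ (4 * t) / m ^ 3)) := by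
    field_simp
    ring
  rw [mul_sub, e2]
  linarith

end Count

/-- If the players' inputs are not co-linear, then the expected overlap of the phase with its
swapped version is bounded away from `1`. -/
theorem sum_re_star_phase_mul_phase_le {t : ℕ} {R G : Type*} [AddCommGroup G] [Finite G]
    [Fintype R] (hR : Fintype.card R = 256 * t ^ 2) (ht : 0 < t) (χ : R → AddChar G ℂ)
    (y : Fin 4 → G)
    (hχ : ‖∑ r, χ r (y 0 + y 1 - y 2 - y 3)‖ ^ 2 ≤ (Fintype.card R : ℝ) ^ 2 / 2) :
    ∑ b : Fin 4 × Fin t → R, (star (phase χ y b) * phase χ y (swapCollisions b)).re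
      ≤ (1 - 1 / 2 ^ 18) * (Fintype.card R : ℝ) ^ (4 * t) := by
  classical
  set s := y 0 + y 1 - y 2 - y 3 with hs
  set h : R → R → ℝ := fun v w => 1 - (star (χ v s) * χ w s).re with hh
  have habs : ∀ v w, |(star (χ v s) * χ w s).re| ≤ 1 := fun v w =>
    (Complex.abs_re_le_norm _).trans_eq (by simp [AddChar.norm_apply])
  have h0 : ∀ v w, 0 ≤ h v w := fun v w => by
    have := (abs_le.1 (habs v w)).2; simp only [hh]; linarith
  have h2 : ∀ v w, h v w ≤ 2 := fun v w => by
    have := (abs_le.1 (habs v w)).1; simp only [hh]; linarith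
  have hsum : ∑ v, ∑ w, h v w = (Fintype.card R : ℝ) ^ 2 - ‖∑ r, χ r s‖ ^ 2 := by
    have e : (((‖∑ r, χ r s‖ ^ 2 : ℝ)) : ℂ) = ∑ v, ∑ w, star (χ v s) * χ w s := by
      push_cast
      rw [← Complex.conj_mul', map_sum, Finset.sum_mul_sum]
      rfl
    have e' := congrArg Complex.re e
    simp only [Complex.ofReal_re, Complex.re_sum] at e'
    simp only [hh, Finset.sum_sub_distrib, e']
    simp [pow_two]
  have hRpos : 0 < Fintype.card R := by rw [hR]; positivity
  set m : ℝ := (Fintype.card R : ℝ) with hm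
  have hmt : m = 256 * (t : ℝ) ^ 2 := by rw [hm, hR]; push_cast; ring
  have hpt : ∀ b : Fin 4 × Fin t → R,
      (∑ τ, if Collides τ b then h (b (0, τ 0)) (b (2, τ 2)) else 0)
        ≤ 1 - (star (phase χ y b) * phase χ y (swapCollisions b)).re := by
    intro b
    by_cases hex : ∃ τ, Collides τ b
    · obtain ⟨τ, hτ⟩ := hex
      rw [Finset.sum_eq_single τ, if_pos hτ, hτ.star_phase_mul_phase]
      · intro τ' _ hne
        exact if_neg fun h' => hne (h'.unique hτ)
      · simp
    · rw [Finset.sum_eq_zero fun τ _ => if_neg fun h' => hex ⟨τ, h'⟩, swapCollisions_of_not hex,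
        star_phase_mul_self]
      simp
  have hall := Finset.sum_le_sum fun b (_ : b ∈ Finset.univ) => hpt b
  rw [Finset.sum_comm, Finset.sum_sub_distrib] at hall
  have hlow := Finset.sum_le_sum fun τ (_ : τ ∈ (Finset.univ : Finset (Fin 4 → Fin t))) =>
    le_sum_collides τ h h0 h2 hRpos
  rw [Finset.sum_const, Finset.card_univ, nsmul_eq_mul] at hlow
  have hfin := hlow.trans hall
  rw [hsum] at hfin
  simp only [Finset.sum_const, Finset.card_univ, nsmul_eq_mul, mul_one, Fintype.card_fun,
    Fintype.card_prod, Fintype.card_fin, Nat.cast_pow, ← hm] at hfin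
  have ht' : (0 : ℝ) < t := by exact_mod_cast ht
  have hm0 : 0 < m := by rw [hmt]; positivity
  -- There are `t ^ 4` choices of `τ`. The bracket is at least `(1 - 1/2 - 1/8) m²`, and `m = 256
  -- t²` gives the fraction `3 / 2 ^ 19`.
  have hq : m ^ (4 * t) / 2 ^ 18 ≤
      (t : ℝ) ^ 4 * (m ^ (4 * t) / m ^ 4 * (m ^ 2 - ‖∑ r, χ r s‖ ^ 2 - 32 * t ^ 2 * m)) := by
    have h1 : m ^ 2 * (3 / 8) ≤ m ^ 2 - ‖∑ r, χ r s‖ ^ 2 - 32 * t ^ 2 * m := by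
      have : 32 * t ^ 2 * m = m ^ 2 / 8 := by rw [hmt]; ring
      linarith
    calc m ^ (4 * t) / 2 ^ 18 ≤ (t : ℝ) ^ 4 * (m ^ (4 * t) / m ^ 4 * (m ^ 2 * (3 / 8))) := by
          generalize hM : m ^ (4 * t) = M
          have hMpos : 0 < M := by rw [← hM]; positivity
          have : (t : ℝ) ^ 4 * (M / m ^ 4 * (m ^ 2 * (3 / 8))) = M * (3 / 2 ^ 19) := by
            rw [hmt]; field_simp; norm_num
          rw [this]
          linarith
      _ ≤ _ := by gcongr
  linarith

/-! ### The referee's projection and its tensor powers -/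

section Projections

variable {Ω : Type*}

theorem posSemidef_of_isHermitian_of_mul_self [Fintype Ω] {M : Matrix Ω Ω ℂ} (h : M.IsHermitian)
    (hM : M * M = M) : M.PosSemidef := by
  have := Matrix.posSemidef_conjTranspose_mul_self M
  rwa [h.eq, hM] at this

theorem posSemidef_one_sub_of_mul_self [Fintype Ω] [DecidableEq Ω] {M : Matrix Ω Ω ℂ} (h : M.IsHermitian)
    (hM : M * M = M) : (1 - M).PosSemidef :=
  posSemidef_of_isHermitian_of_mul_self (Matrix.isHermitian_one.sub h)
    (by simp [sub_mul, mul_sub, hM])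

/-- The orthogonal projection onto the vectors invariant under an involution of the basis. -/
def involutionProj [DecidableEq Ω] (σ : Ω → Ω) : Matrix Ω Ω ℂ :=
  Matrix.of fun b c => 1 / 2 * ((if b = c then 1 else 0) + if σ b = c then 1 else 0)

theorem involutionProj_isHermitian [DecidableEq Ω] {σ : Ω → Ω} (hσ : Function.Involutive σ) :
    (involutionProj σ).IsHermitian := by
  ext b c
  have h : σ c = b ↔ σ b = c := by rw [hσ.eq_iff, eq_comm]
  simp only [involutionProj, Matrix.conjTranspose_apply, Matrix.of_apply, h, eq_comm (a := c)]
  split_ifs <;> simp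

theorem involutionProj_mul_self [Fintype Ω] [DecidableEq Ω] {σ : Ω → Ω} (hσ : Function.Involutive σ) :
    involutionProj σ * involutionProj σ = involutionProj σ := by
  ext b c
  simp only [involutionProj, Matrix.mul_apply, Matrix.of_apply, mul_assoc, add_mul, ite_mul,
    one_mul, zero_mul, ← Finset.mul_sum, Finset.sum_add_distrib, Finset.sum_ite_eq,
    Finset.mem_univ, if_true, hσ b]
  ring

theorem star_dotProduct_involutionProj [Fintype Ω] [DecidableEq Ω] (σ : Ω → Ω) (ψ : Ω → ℂ) :
    star ψ ⬝ᵥ involutionProj σ *ᵥ ψ =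
      ∑ b, 1 / 2 * (star (ψ b) * ψ b + star (ψ b) * ψ (σ b)) := by
  refine Finset.sum_congr rfl fun b _ => ?_
  simp only [Matrix.mulVec, dotProduct, involutionProj, Matrix.of_apply, mul_assoc, add_mul,
    ite_mul, one_mul, zero_mul, ← Finset.mul_sum, Finset.sum_add_distrib, Finset.sum_ite_eq,
    Finset.mem_univ, if_true, Pi.star_apply]
  ring

end Projections

section TensorPower

variable {ι Ω : Type*} [Fintype ι]

/-- The tensor power of a matrix, in the product basis. -/
def tensorPower (ι : Type*) [Fintype ι] {Ω : Type*} (M : Matrix Ω Ω ℂ) : Matrix (ι → Ω) (ι → Ω) ℂ :=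
  Matrix.of fun b c => ∏ k, M (b k) (c k)

theorem tensorPower_isHermitian {M : Matrix Ω Ω ℂ} (h : M.IsHermitian) :
    (tensorPower ι M).IsHermitian := by
  ext b c
  simp only [tensorPower, Matrix.conjTranspose_apply, Matrix.of_apply, star_prod, h.apply]

theorem tensorPower_mul [DecidableEq ι] [Fintype Ω] (M N : Matrix Ω Ω ℂ) :
    tensorPower ι M * tensorPower ι N = tensorPower ι (M * N) := by
  ext b c
  simp only [tensorPower, Matrix.mul_apply, Matrix.of_apply, ← Finset.prod_mul_distrib,
    Fintype.prod_sum]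

theorem star_dotProduct_tensorPower [DecidableEq ι] [Fintype Ω] (M : Matrix Ω Ω ℂ) (ψ : Ω → ℂ) :
    star (fun b : ι → Ω => ∏ k, ψ (b k)) ⬝ᵥ tensorPower ι M *ᵥ (fun b => ∏ k, ψ (b k)) =
      (star ψ ⬝ᵥ M *ᵥ ψ) ^ Fintype.card ι := by
  simp only [Matrix.mulVec, dotProduct, tensorPower, Matrix.of_apply, Pi.star_apply, star_prod,
    ← Finset.prod_mul_distrib]
  have h (b : ι → Ω) :
      ∑ c : ι → Ω, ∏ k, M (b k) (c k) * ψ (c k) = ∏ k, ∑ c, M (b k) c * ψ c :=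
    (Fintype.prod_sum fun k c => M (b k) c * ψ c).symm
  simp only [h]
  rw [← Finset.card_univ, ← Finset.prod_const, Fintype.prod_sum]
  refine Finset.sum_congr rfl fun b _ => ?_
  rw [Finset.prod_mul_distrib]

end TensorPower

/-! ### Assembling the protocol -/

/-- A protocol from message vectors indexed by an arbitrary type with `2 ^ N` elements, and a
projection in an arbitrary relabelling of the product basis. -/
theorem exists_quantumSMPProtocol {k N : ℕ} {X S Ω : Type*} [Fintype S] [Fintype Ω]
    [DecidableEq Ω] (hS : Fintype.card S = 2 ^ N) (ψ : Fin k → X → S → ℂ)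
    (hψ : ∀ i x, ∑ s, ‖ψ i x s‖ ^ 2 = 1) (F : (Fin k → S) ≃ Ω) {M : Matrix Ω Ω ℂ}
    (hM : M.IsHermitian) (hMM : M * M = M) :
    ∃ P : QuantumSMPProtocol k X, P.cost = k * N ∧ ∀ (x : Fin k → X) (Ψ : Ω → ℂ),
      (∀ s, Ψ (F s) = ∏ i, ψ i (x i) (s i)) → P.acceptProb x = (star Ψ ⬝ᵥ M *ᵥ Ψ).re := by
  have e : (Fin N → Fin 2) ≃ S := Fintype.equivOfCardEq (by simp [hS])
  let E : (Fin k → Fin N → Fin 2) ≃ Ω := (Equiv.piCongrRight fun _ => e).trans F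
  let P : QuantumSMPProtocol k X :=
    { qubits := fun _ => N
      message := fun i x => WithLp.toLp 2 fun w => ψ i x (e w)
      norm_message := fun i x => by
        rw [EuclideanSpace.norm_eq, Real.sqrt_eq_one, ← hψ i x,
          ← Equiv.sum_comp e fun s => ‖ψ i x s‖ ^ 2]
      accept := M.submatrix E E
      accept_posSemidef := (posSemidef_of_isHermitian_of_mul_self hM hMM).submatrix E
      one_sub_accept_posSemidef := by
        have := (posSemidef_one_sub_of_mul_self hM hMM).submatrix E
        rwa [Matrix.submatrix_sub, Pi.sub_apply, Pi.sub_apply, Matrix.submatrix_one_equiv] at this }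
  refine ⟨P, ?_, fun x Ψ hΨ => ?_⟩
  · simp [P, QuantumSMPProtocol.cost]
  · have hj : P.jointState x = Ψ ∘ E := by
      funext b
      exact (hΨ fun i => e (b i)).symm
    rw [QuantumSMPProtocol.acceptProb, hj]
    congr 1
    change star (Ψ ∘ E) ⬝ᵥ (M.submatrix E E *ᵥ (Ψ ∘ E)) = _
    rw [Matrix.submatrix_mulVec_equiv, Function.comp_assoc, Equiv.self_comp_symm,
      Function.comp_id]
    exact Equiv.sum_comp E fun c => star (Ψ c) * (M *ᵥ Ψ) c

/-- The protocol in which each player sends `l * t` copies of the fingerprint of its input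
provided by `|R| = 256 t²` characters, and the referee, in each of the `l` blocks, projects onto
the vectors invariant under the exchange of two collisions. -/
theorem exists_protocol_lin_four {G R : Type*} [AddCommGroup G] [Finite G] [Fintype R]
    {t q : ℕ} (hR : Fintype.card R = 256 * t ^ 2) (hRq : Fintype.card R = 2 ^ q) (ht : 0 < t)
    (χ : R → AddChar G ℂ)
    (hχ : ∀ s, s ≠ 0 → ‖∑ r, χ r s‖ ^ 2 ≤ (Fintype.card R : ℝ) ^ 2 / 2) (l : ℕ) :
    ∃ P : QuantumSMPProtocol 4 G, P.cost = 4 * (q * t * l) ∧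
      ∀ x, (Lin 4 G x → P.acceptProb x = 1) ∧
        (¬ Lin 4 G x → P.acceptProb x ≤ (1 - 1 / 2 ^ 19 : ℝ) ^ l) := by
  classical
  set m : ℝ := (Fintype.card R : ℝ) with hm
  have hm0 : 0 < m := Nat.cast_pos.2 (by rw [hR]; positivity)
  set c : ℝ := (√m)⁻¹ with hc
  have hc2 : c ^ 2 = m⁻¹ := by rw [hc, inv_pow, Real.sq_sqrt hm0.le]
  have hc0 : 0 ≤ c := by positivity
  let sgn : Fin 4 → G → G := ![id, id, Neg.neg, Neg.neg]
  -- Regroup the registers by block instead of by player, so that the state becomes an `l`-fold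
  -- tensor power.
  let F : (Fin 4 → Fin l → Fin t → R) ≃ (Fin l → Fin 4 × Fin t → R) :=
    { toFun := fun s k p => s p.1 k p.2
      invFun := fun b i k a => b k (i, a)
      left_inv := fun _ => rfl
      right_inv := fun _ => rfl }
  have hA := involutionProj_isHermitian (swapCollisions_involutive (t := t) (R := R))
  have hAA := involutionProj_mul_self (swapCollisions_involutive (t := t) (R := R))
  obtain ⟨P, hP, hacc⟩ := exists_quantumSMPProtocol (N := q * t * l) (X := G)
    (S := Fin l → Fin t → R)
    (by simp [hRq, pow_mul])
    (fun i x s => ∏ k, ∏ a, ((c : ℂ) * χ (s k a) (sgn i x)))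
    (by
      intro i x
      have : ∀ s : Fin l → Fin t → R,
          ‖∏ k, ∏ a, ((c : ℂ) * χ (s k a) (sgn i x))‖ ^ 2 = (m⁻¹ ^ t) ^ l := by
        intro s
        simp only [norm_prod, norm_mul, AddChar.norm_apply, Complex.norm_real, Real.norm_eq_abs,
          abs_of_nonneg hc0, mul_one, Finset.prod_const, Finset.card_univ, Fintype.card_fin]
        rw [← hc2]; ring
      simp only [this, Finset.sum_const, Finset.card_univ, Fintype.card_fun, Fintype.card_fin,
        nsmul_eq_mul, Nat.cast_pow, ← hm]
      rw [← mul_pow, ← mul_pow, mul_inv_cancel₀ hm0.ne', one_pow, one_pow])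
    F (tensorPower_isHermitian (ι := Fin l) hA) (by rw [tensorPower_mul, hAA])
  refine ⟨P, hP, fun x => ?_⟩
  set y : Fin 4 → G := fun i => sgn i (x i) with hy
  have hys : y 0 + y 1 - y 2 - y 3 = ∑ i, x i := by
    simp [hy, sgn, Fin.sum_univ_four]
  let ψ : (Fin 4 × Fin t → R) → ℂ := fun b => (c : ℂ) ^ (4 * t) * phase χ y b
  have hΨ := hacc x (fun b => ∏ k, ψ (b k)) (by
    intro s
    rw [Finset.prod_comm]
    refine Finset.prod_congr rfl fun k _ => ?_
    simp only [ψ, phase, F, Equiv.coe_fn_mk, Finset.prod_mul_distrib, Fintype.prod_prod_type,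
      Finset.prod_const, Finset.card_univ, Fintype.card_fin, ← pow_mul, hy]
    rw [mul_comm t 4])
  rw [star_dotProduct_tensorPower, Fintype.card_fin] at hΨ
  set z : ℂ := star ψ ⬝ᵥ involutionProj swapCollisions *ᵥ ψ with hz
  have hz0 : 0 ≤ z := (posSemidef_of_isHermitian_of_mul_self hA hAA).dotProduct_mulVec_nonneg ψ
  have hzre : z = (z.re : ℂ) := by
    apply Complex.ext
    · simp
    · simpa using (Complex.nonneg_iff.1 hz0).2.symm
  have hzr0 : 0 ≤ z.re := (Complex.nonneg_iff.1 hz0).1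
  have hacc' : P.acceptProb x = z.re ^ l := by
    rw [hΨ, hzre, ← Complex.ofReal_pow, Complex.ofReal_re]
    simp
  have hcc : ((c : ℂ) ^ (4 * t)) * ((c : ℂ) ^ (4 * t)) = (((m ^ (4 * t))⁻¹ : ℝ) : ℂ) := by
    rw [← mul_pow, ← pow_two, ← Complex.ofReal_pow, hc2, ← Complex.ofReal_pow, inv_pow]
  have hzsum : z = (((m ^ (4 * t))⁻¹ : ℝ) : ℂ) * ∑ b : Fin 4 × Fin t → R,
      1 / 2 * (1 + star (phase χ y b) * phase χ y (swapCollisions b)) := by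
    rw [hz, star_dotProduct_involutionProj, Finset.mul_sum, ← hcc]
    refine Finset.sum_congr rfl fun b _ => ?_
    simp only [ψ, star_mul', star_pow, Complex.star_def, Complex.conj_ofReal]
    have := star_phase_mul_self χ y b
    rw [Complex.star_def] at this
    linear_combination (1 / 2 * ((c : ℂ) ^ (4 * t)) * ((c : ℂ) ^ (4 * t))) * this
  have hzr : z.re = (m ^ (4 * t))⁻¹ * (1 / 2 * (m ^ (4 * t) + ∑ b : Fin 4 × Fin t → R,
      (star (phase χ y b) * phase χ y (swapCollisions b)).re)) := by
    rw [hzsum, Complex.re_ofReal_mul, ← Finset.mul_sum, Finset.sum_add_distrib]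
    congr 1
    rw [show (1 / 2 : ℂ) = ((1 / 2 : ℝ) : ℂ) by norm_num, Complex.re_ofReal_mul]
    congr 1
    rw [Complex.add_re, Complex.re_sum, Complex.re_sum]
    congr 1
    simp [hm]
  have hmt : 0 < m ^ (4 * t) := by positivity
  refine ⟨fun hx => ?_, fun hx => ?_⟩
  · have h1 := star_phase_mul_phase_of_eq (t := t) χ (hys.trans hx)
    rw [hacc', hzr]
    simp only [h1, Complex.one_re, Finset.sum_const, Finset.card_univ, Fintype.card_fun,
      Fintype.card_prod, Fintype.card_fin, nsmul_eq_mul, mul_one, Nat.cast_pow, ← hm]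
    rw [show (m ^ (4 * t))⁻¹ * (1 / 2 * (m ^ (4 * t) + m ^ (4 * t))) = 1 by field_simp; norm_num,
      one_pow]
  · have hle := sum_re_star_phase_mul_phase_le hR ht χ y (hχ _ (by rw [hys]; exact hx))
    rw [hacc']
    refine pow_le_pow_left₀ hzr0 ?_ l
    -- Acceptance of a block is the mean of `1` and the overlap, so the gap `1 / 2 ^ 18` is halved.
    rw [hzr, inv_mul_le_iff₀ hmt]
    linarith

end

theorem theorem2 (ε : ℝ) (hε : 0 < ε) :
    ∃ C : ℝ, ∀ n : ℕ, 2 ≤ n →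
      ∀ (G : Type*) [AddCommGroup G] [Finite G], Nat.card G ≤ 2 ^ n →
        ∃ P : QuantumSMPProtocol 4 G,
          P.Decides (Lin 4 G) ε ∧ (P.cost : ℝ) ≤ C * (Real.sqrt n * Real.log n) := by
  obtain ⟨l, hl⟩ := exists_pow_lt_of_lt_one hε (by norm_num : (1 - 1 / 2 ^ 19 : ℝ) < 1)
  -- The cost is `8 * l * 2 ^ j * (j + 4)`, and `j + 4 ≤ 9 * log n`.
  refine ⟨72 * l, fun n hn G _ _ hG => ?_⟩
  -- With `t = 2 ^ j ≤ √n`, the family has size `256 * 4 ^ j = 64 * 4 ^ (j + 1)`, which exceeds `8 *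
  -- (n + 2)` and is a power of two.
  set j := Nat.log 4 n with hj
  have hjn : 4 ^ j ≤ n := Nat.pow_log_le_self 4 (by omega)
  have hnj : n < 4 ^ (j + 1) := Nat.lt_pow_succ_log_self (by norm_num) n
  have hR : Fintype.card (Fin (2 * (j + 4)) → Fin 2) = 256 * (2 ^ j) ^ 2 := by
    simp only [Fintype.card_fun, Fintype.card_fin]
    ring
  have h4 : (2 ^ j) ^ 2 = 4 ^ j := by rw [← pow_mul, mul_comm, pow_mul]; norm_num
  obtain ⟨χ, hχ⟩ := exists_addChar_family n G (Fin (2 * (j + 4)) → Fin 2) hG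
    (by rw [hR, h4]; rw [pow_succ] at hnj; omega)
  obtain ⟨P, hP, hacc⟩ := exists_protocol_lin_four (q := 2 * (j + 4)) hR (by simp) (by positivity) χ hχ l
  refine ⟨P, fun x => ⟨fun hx => ?_, fun hx => ?_⟩, ?_⟩
  · rw [(hacc x).1 hx]; linarith
  · exact ((hacc x).2 hx).trans hl.le
  · have hn0 : (0 : ℝ) < n := by exact_mod_cast (by omega : 0 < n)
    have hsqrt : (2 : ℝ) ^ j ≤ √n := by
      refine Real.le_sqrt_of_sq_le ?_
      exact_mod_cast h4.trans_le hjn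
    have hlog2 : 1 / 2 ≤ Real.log 2 := by linarith [Real.log_two_gt_d9]
    have hlogn : Real.log 2 ≤ Real.log n := Real.log_le_log (by norm_num) (by exact_mod_cast hn)
    have hlogj : (j : ℝ) ≤ Real.log n := by
      have h1 : Real.log ((4 : ℝ) ^ j) ≤ Real.log n :=
        Real.log_le_log (by positivity) (by exact_mod_cast hjn)
      have h2 : Real.log 4 = 2 * Real.log 2 := by
        rw [show (4 : ℝ) = 2 ^ 2 by norm_num, Real.log_pow]; norm_num
      rw [Real.log_pow, h2] at h1
      have : (j : ℝ) * 1 ≤ j * (2 * Real.log 2) := by gcongr; linarith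
      linarith
    rw [hP]
    push_cast
    calc (4 : ℝ) * (2 * (j + 4) * 2 ^ j * l) = 8 * l * (2 ^ j * (j + 4)) := by ring
      _ ≤ 8 * l * (√n * (9 * Real.log n)) := by gcongr; linarith
      _ = _ := by ring
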